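/- Let $\lambda$ be a limit ordinal of cofinality $\omega$, and let $\mathcal{E}_\lambda$ be the set of nontrivial (that is, different from the identity) elementary embeddings $j\colon \langle V_\lambda,\in\rangle\to\langle V_\lambda,\in\rangle$. For $j\in\mathcal{E}_\lambda$ and $A\in V_{\lambda+1}$ (that is, $A\subseteq V_\lambda$) put $$j\cdot A = j(A)=\bigcup_{\alpha<\lambda} j(A\cap V_\alpha).$$ For $k\in\mathcal{E}_\lambda$ write $jk=j\cdot k$, where $k$ is regarded as the set $\{\langle x,k(x)\rangle : x\in V_\lambda\}\subseteq V_\lambda$ of ordered pairs; $k$ is a square root of $j$ if $kk=j$. Let $\operatorname{rng}^+ k=\{A\in V_{\lambda+1} : \exists B\in V_{\lambda+1}\ (k(B)=A)\}$ be the extended range of $k$. Call $j\in\mathcal{E}_\lambda$ $\Sigma^1_1$-elementary if for every formula $\varphi$ of the form $\exists X_1\cdots\exists X_q\,\psi$, where $X_1,\dots,X_q$ are second-order variables ranging over the subsets of the structure and $\psi$ is a formula in the language $\{\in\}$ without second-order quantifiers (in which both first-order and second-order variables may be free), and for all parameters $A_1,\dots,A_p\subseteq V_\lambda$ and $x_1,\dots,x_r\in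 V_\lambda$, $$V_\lambda\models\varphi[A_1,\dots,A_p,x_1,\dots,x_r]\iff V_\lambda\models\varphi[j(A_1),\dots,j(A_p),j(x_1),\dots,j(x_r)].$$ Suppose that $j\in\mathcal{E}_\lambda$ is $\Sigma^1_1$-elementary. Then for any $a_0,\dots,a_m,b_0,\dots,b_n\in V_{\lambda+1}$ there is $k\in\mathcal{E}_\lambda$ that is a square root of $j$ such that $a_0,\dots,a_m\in\operatorname{rng}^+ k$ and $k(b_\ell)=j(b_\ell)$ for all $\ell\le n$. -/

import Mathlib

open scoped FirstOrder
open scoped ZFSet Cardinal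

universe u

namespace RankEmb

/-- The non-logical symbols of set theory with second-order variables from `σ`: the binary relation
`∈`, and for every second-order variable `X : σ` the unary predicate "`· ∈ X`". -/
inductive SetRel (σ : Type) : ℕ → Type
  | mem : SetRel σ 2
  | var (X : σ) : SetRel σ 1

/-- Language of set theory with second-order variables from `σ`. Its first-order formulas are the
formulas without second-order quantifiers whose second-order variables are in `σ`. -/
def setLang (σ : Type) : FirstOrder.Language.{0, 0} where
  Functions := fun _ => Empty
  Relations := SetRel σ

/-- The first-order language `{∈}` of set theory. -/
abbrev memLang : FirstOrder.Language.{0, 0} := setLang Empty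

/-- The structure `⟨M, ∈⟩` together with the assignment `X ↦ S X` of the second-order
variables. -/
@[reducible]
def setStructure {σ : Type} (M : ZFSet.{u}) (S : σ → ZFSet.{u}) : (setLang σ).Structure M where
  funMap := fun f => Empty.elim f
  RelMap := fun {_} R =>
    match R with
    | SetRel.mem => fun x => (x 0 : ZFSet.{u}) ∈ (x 1 : ZFSet.{u})
    | SetRel.var X => fun x => (x 0 : ZFSet.{u}) ∈ S X

/-- Every set `M` is a structure `⟨M, ∈⟩` for the language `{∈}`. -/
instance memStructure (M : ZFSet.{u}) : memLang.Structure M :=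
  setStructure M (fun X : Empty => X.elim)

/-- Elementary embeddings `⟨V_λ, ∈⟩ → ⟨V_λ, ∈⟩`, including the identity. -/
abbrev ElemEmb (lam : Ordinal.{u}) : Type (u + 1) := (V_ lam) ↪ₑ[memLang] (V_ lam)

/-- `𝓔_λ`: the nontrivial elementary embeddings `V_λ → V_λ`. -/
def E (lam : Ordinal.{u}) : Set (ElemEmb lam) := {j | ∃ x, j x ≠ x}

theorem inter_mem {lam α : Ordinal.{u}} (hα : α < lam) (A : ZFSet.{u}) :
    A ∩ V_ α ∈ V_ lam :=
  ZFSet.mem_vonNeumann'.2 ⟨α, hα, fun _ hx => (ZFSet.mem_inter.1 hx).2⟩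

/-- The application `j · A = ⋃_{α < λ} j (A ∩ V_α)`, for `A ⊆ V_λ`. -/
noncomputable def app {lam : Ordinal.{u}} (j : ElemEmb lam) (A : ZFSet.{u}) : ZFSet.{u} :=
  ZFSet.iUnion fun α : Set.Iio lam => (j ⟨A ∩ V_ (α : Ordinal.{u}), inter_mem α.2 A⟩ : ZFSet.{u})

/-- The embedding `j` as a set of ordered pairs `⟨x, j x⟩`. -/
noncomputable def graph {lam : Ordinal.{u}} (j : ElemEmb lam) : ZFSet.{u} :=
  ZFSet.range fun x : V_ lam => ZFSet.pair x (j x)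

/-- `k` is a square root of `j`: `k · k = j`, with `k` applied to itself as a set of pairs. -/
def IsSquareRoot {lam : Ordinal.{u}} (k j : ElemEmb lam) : Prop :=
  app k (graph k) = graph j

/-- The extended range `rng⁺ j`: the range of `A ↦ j · A` on `V_{λ+1}`. -/
def extRange {lam : Ordinal.{u}} (j : ElemEmb lam) : Set ZFSet.{u} :=
  {A | A ∈ V_ (lam + 1) ∧ ∃ B ∈ V_ (lam + 1), app j B = A}

/-- `⟨M, ∈⟩ ⊨ ∃ X₁ … X_q ψ(X₁, …, X_q, A₁, …, A_p, x₁, …, x_r)`, where `ψ` has no second-order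
quantifiers, the `X`'s range over the subsets of `M`, and the parameters are the subsets `A` and the
elements `x` of `M`. -/
def SigmaHolds (M : ZFSet.{u}) {p q r : ℕ} (ψ : (setLang (Fin p ⊕ Fin q)).Formula (Fin r))
    (A : Fin p → ZFSet.{u}) (x : Fin r → M) : Prop :=
  ∃ X : Fin q → ZFSet.{u}, (∀ i, X i ⊆ M) ∧
    @FirstOrder.Language.Formula.Realize _ M (setStructure M (Sum.elim A X)) _ ψ x

/-- `j` is `Σ¹₁`-elementary, for first-order and second-order parameters. -/
def IsSigmaOneOne {lam : Ordinal.{u}} (j : ElemEmb lam) : Prop :=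
  ∀ (p q r : ℕ) (ψ : (setLang (Fin p ⊕ Fin q)).Formula (Fin r))
    (A : Fin p → ZFSet.{u}) (x : Fin r → (V_ lam)), (∀ i, A i ∈ V_ (lam + 1)) →
    (SigmaHolds (V_ lam) ψ A x ↔ SigmaHolds (V_ lam) ψ (fun i => app j (A i)) (fun i => j (x i)))

end RankEmb

/-!
Elementarity of `k : V_λ → V_λ` is a `Σ¹₁` property of its graph. There are only countably many
formulas, so they can be coded by elements of `V_λ`, and the satisfaction relation becomes a subset
`T` of `V_λ`. Conversely, whenever the sections of some `T` are closed under the operations that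
generate the definable relations, and `k` preserves all these sections, `k` is elementary.

Hence "there are an elementary `k` and a set `X` with `k · k = j`, `k · X = A` and `k · B = j · B`"
is `Σ¹₁` in the parameters `j`, `A`, `B` and `j · B`. Its image under `j` asks for `k` and `X` with
`k · k = j · j`, `k · X = j · A` and `k · (j · B) = j · (j · B)`: take `k = j` and `X = A`. By
`Σ¹₁`-elementarity of `j`, the original assertion holds as well.

A countable family of sets is coded as one set of tagged elements. The tags are definable, hence
fixed by all elementary embeddings.
-/

namespace RankEmb

open FirstOrder.Language

section Expressible

variable {M : ZFSet.{u}} {σ : Type} {n : ℕ}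

/-- A predicate on assignments of second-order variables and of `n` first-order variables in `M` is
*expressible* if one formula without second-order quantifiers defines it under all assignments. -/
def Expressible (P : (σ → ZFSet.{u}) → (Fin n → M) → Prop) : Prop :=
  ∃ φ : (setLang σ).Formula (Fin n), ∀ S v,
    @Formula.Realize _ M (setStructure M S) _ φ v ↔ P S v

namespace Expressible

variable {P Q : (σ → ZFSet.{u}) → (Fin n → M) → Prop}
  {R : (σ → ZFSet.{u}) → (Fin n → M) → M → Prop}

theorem congr (hP : Expressible P) (h : ∀ S v, P S v ↔ Q S v) : Expressible Q :=
  hP.imp fun _ hφ S v => (hφ S v).trans (h S v)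

theorem false : Expressible fun (_ : σ → ZFSet.{u}) (_ : Fin n → M) => False :=
  ⟨⊥, fun _ _ => Iff.rfl⟩

theorem imp (hP : Expressible P) (hQ : Expressible Q) : Expressible fun S v => P S v → Q S v := by
  obtain ⟨φ, hφ⟩ := hP
  obtain ⟨ψ, hψ⟩ := hQ
  exact ⟨φ.imp ψ, fun S v => imp_congr (hφ S v) (hψ S v)⟩

theorem not (hP : Expressible P) : Expressible fun S v => ¬P S v :=
  hP.imp false

theorem and (hP : Expressible P) (hQ : Expressible Q) : Expressible fun S v => P S v ∧ Q S v :=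
  (hP.imp hQ.not).not.congr fun _ _ => by tauto

theorem or (hP : Expressible P) (hQ : Expressible Q) : Expressible fun S v => P S v ∨ Q S v :=
  (hP.not.imp hQ).congr fun _ _ => or_iff_not_imp_left.symm

theorem iff (hP : Expressible P) (hQ : Expressible Q) : Expressible fun S v => (P S v ↔ Q S v) :=
  ((hP.imp hQ).and (hQ.imp hP)).congr fun _ _ => iff_iff_implies_and_implies.symm

theorem all
    (hR : Expressible fun S (v : Fin (n + 1) → M) => R S (Fin.init v) (v (Fin.last n))) :
    Expressible fun S v => ∀ x, R S v x := by
  obtain ⟨φ, hφ⟩ := hR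
  refine ⟨(φ.relabel finSumFinEquiv.symm).iAlls (Fin 1), fun S v => ?_⟩
  let _ := setStructure M S
  have realize_append (x : Fin 1 → M) :
      (φ.relabel finSumFinEquiv.symm).Realize (Sum.elim v x) ↔ R S v (x 0) := by
    have append_eq : Sum.elim v x ∘ finSumFinEquiv.symm = Fin.append v x :=
      (Equiv.comp_symm_eq _ _ _).2 Fin.append_comp_sumElim.symm
    rw [Formula.realize_relabel, append_eq, hφ, Fin.append_right_eq_snoc]
    simp only [Fin.init_snoc, Fin.snoc_last]
  simp only [Formula.realize_iAlls, realize_append]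
  exact (Equiv.funUnique (Fin 1) M).forall_congr fun _ => Iff.rfl

theorem ex
    (hR : Expressible fun S (v : Fin (n + 1) → M) => R S (Fin.init v) (v (Fin.last n))) :
    Expressible fun S v => ∃ x, R S v x :=
  (all hR.not).not.congr fun _ _ => not_forall_not

theorem comp (hP : Expressible P) {m : ℕ} (ρ : Fin n → Fin m) :
    Expressible fun S (v : Fin m → M) => P S (v ∘ ρ) := by
  obtain ⟨φ, hφ⟩ := hP
  refine ⟨φ.relabel ρ, fun S v => ?_⟩
  let _ := setStructure M S
  exact Formula.realize_relabel.trans (hφ S _)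

theorem eq_var (i k : Fin n) :
    Expressible fun (_ : σ → ZFSet.{u}) (v : Fin n → M) => v i = v k := by
  refine ⟨Term.equal (Term.var i) (Term.var k), fun S v => ?_⟩
  let _ := setStructure M S
  exact Formula.realize_equal

theorem mem_var (i k : Fin n) :
    Expressible fun (_ : σ → ZFSet.{u}) (v : Fin n → M) => (v i).1 ∈ (v k).1 := by
  refine ⟨Relations.formula₂ (L := setLang σ) (SetRel.mem : SetRel σ 2)
    (Term.var i) (Term.var k), fun S v => ?_⟩
  let _ := setStructure M S
  exact Formula.realize_rel₂

theorem pred_var (X : σ) (i : Fin n) :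
    Expressible fun S (v : Fin n → M) => (v i).1 ∈ S X := by
  refine ⟨Relations.formula₁ (L := setLang σ) (SetRel.var X : SetRel σ 1)
    (Term.var i), fun S v => ?_⟩
  let _ := setStructure M S
  exact Formula.realize_rel₁

theorem map_iff {P : (Empty → ZFSet.{u}) → (Fin n → M) → Prop} (hP : Expressible P)
    (j : M ↪ₑ[memLang] M) (v : Fin n → M) :
    P (fun X => X.elim) (j ∘ v) ↔ P (fun X => X.elim) v := by
  obtain ⟨φ, hφ⟩ := hP
  rw [← hφ, ← hφ]
  exact j.map_formula φ v

end Expressible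

end Expressible

/-- Transitive sets which contain `∅` and are closed under Kuratowski pairs. In such a set the
ordered pair is definable, and finite tuples can be coded by elements. -/
class IsPairClosed (M : ZFSet.{u}) : Prop where
  isTransitive : M.IsTransitive
  empty_mem : ∅ ∈ M
  pair_mem {x y : ZFSet.{u}} : x ∈ M → y ∈ M → ZFSet.pair x y ∈ M

variable {M : ZFSet.{u}}

theorem eq_of_forall_mem_iff {A B : ZFSet.{u}} (hA : A ⊆ M) (hB : B ⊆ M)
    (h : ∀ z : M, z.1 ∈ A ↔ z.1 ∈ B) : A = B :=
  ZFSet.ext fun z => ⟨fun hz => (h ⟨z, hA hz⟩).1 hz, fun hz => (h ⟨z, hB hz⟩).2 hz⟩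

theorem exists_realize_eq_var {n : ℕ} (t : memLang.Term (Empty ⊕ Fin n)) :
    ∃ i, ∀ v : Fin n → M, t.realize (Sum.elim Empty.elim v) = v i := by
  rcases t with (i | i) | ⟨f, _⟩
  · exact i.elim
  · exact ⟨i, fun _ => rfl⟩
  · exact Empty.elim f

variable [IsPairClosed M]

theorem mem_of_mem_coe (x : M) {y : ZFSet.{u}} (h : y ∈ x.1) : y ∈ M :=
  IsPairClosed.isTransitive.mem_trans h x.2

theorem coe_subset (x : M) : x.1 ⊆ M :=
  fun _ => mem_of_mem_coe x

/-- The empty set as an element of `M`. -/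
instance : EmptyCollection M :=
  ⟨⟨∅, IsPairClosed.empty_mem⟩⟩

/-- The ordered pair as an operation on `M`. -/
def opair (x y : M) : M :=
  ⟨ZFSet.pair x y, IsPairClosed.pair_mem x.2 y.2⟩

local notation "⟪" x "," y "⟫" => opair x y

@[simp]
theorem opair_inj {x y x' y' : M} : ⟪x, y⟫ = ⟪x', y'⟫ ↔ x = x' ∧ y = y' := by
  simp only [opair, Subtype.mk.injEq, ZFSet.pair_inj, Subtype.coe_inj]

theorem opair_ne_empty (x y : M) : ⟪x, y⟫ ≠ ∅ :=
  fun h => (ZFSet.eq_empty _).1 (congrArg Subtype.val h) {x.1} (ZFSet.mem_pair.2 (.inl rfl))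

theorem forall_notMem_iff_eq_empty {x : M} : (∀ z : M, z.1 ∉ x.1) ↔ x = ∅ := by
  refine Iff.trans ?_ ((ZFSet.eq_empty x.1).symm.trans (Subtype.ext_iff (a2 := ∅)).symm)
  exact ⟨fun h z hz => h ⟨z, mem_of_mem_coe x hz⟩ hz, fun h z => h z.1⟩

theorem forall_mem_iff_eq_pair {x y z : M} :
    (∀ w : M, w.1 ∈ z.1 ↔ w = x ∨ w = y) ↔ z.1 = {x.1, y.1} := by
  simp only [Subtype.ext_iff, ← ZFSet.mem_pair]
  refine ⟨eq_of_forall_mem_iff (coe_subset z) fun w hw => ?_, fun h w => by rw [h]⟩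
  rcases ZFSet.mem_pair.1 hw with rfl | rfl <;> exact Subtype.prop _

theorem exists_pair_eq_iff_eq_opair {x y z : M} :
    (∃ a b : M, (∀ w : M, w.1 ∈ a.1 ↔ w = x ∨ w = x) ∧ (∀ w : M, w.1 ∈ b.1 ↔ w = x ∨ w = y) ∧
      ∀ w : M, w.1 ∈ z.1 ↔ w = a ∨ w = b) ↔ z = ⟪x, y⟫ := by
  simp only [forall_mem_iff_eq_pair, ZFSet.pair_eq_singleton]
  constructor
  · rintro ⟨a, b, ha, hb, hz⟩
    exact Subtype.ext (by rw [hz, ha, hb]; rfl)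
  · rintro rfl
    have mem_of_mem_opair {w} : w ∈ ZFSet.pair x.1 y.1 → w ∈ M := mem_of_mem_coe ⟪x, y⟫
    exact ⟨⟨{x.1}, mem_of_mem_opair (ZFSet.mem_pair.2 (.inl rfl))⟩,
      ⟨{x.1, y.1}, mem_of_mem_opair (ZFSet.mem_pair.2 (.inr rfl))⟩, rfl, rfl, rfl⟩

/-- Operations on `M` built from variables and `∅` by forming ordered pairs. -/
inductive IsPairTerm {n : ℕ} : ((Fin n → M) → M) → Prop
  | var (i : Fin n) : IsPairTerm fun v => v i
  | empty : IsPairTerm fun _ => ∅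
  | pair {f g : (Fin n → M) → M} (hf : IsPairTerm f) (hg : IsPairTerm g) :
      IsPairTerm fun v => ⟪f v, g v⟫

namespace Expressible

variable {σ : Type} {n : ℕ} {f g : (Fin n → M) → M}

theorem var_eq_opair_var (i k l : Fin n) :
    Expressible fun (_ : σ → ZFSet.{u}) (v : Fin n → M) => v i = ⟪v k, v l⟫ := by
  refine congr ?_ fun _ _ => exists_pair_eq_iff_eq_opair
  refine .ex (.ex (.and (.all ?_) (.and (.all ?_) (.all ?_)))) <;>
    exact .iff (.mem_var _ _) (.or (.eq_var _ _) (.eq_var _ _))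

theorem var_eq_comp (hf : IsPairTerm f) {m : ℕ} (ρ : Fin n → Fin m) (i : Fin m) :
    Expressible fun (_ : σ → ZFSet.{u}) (v : Fin m → M) => v i = f (v ∘ ρ) := by
  induction hf generalizing m with
  | var k => exact eq_var _ _
  | empty =>
    exact congr (.all (.not (.mem_var (Fin.last m) i.castSucc))) fun _ _ =>
      forall_notMem_iff_eq_empty
  | @pair f g _ _ ihf ihg =>
    refine congr (P := fun _ v => ∃ x y, x = f (v ∘ ρ) ∧ y = g (v ∘ ρ) ∧ v i = ⟪x, y⟫)
      (.ex (.ex (.and ?_ (.and ?_ ?_)))) fun _ v => by simp only [exists_and_left, exists_eq_left]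
    · exact ihf (Fin.castSucc ∘ Fin.castSucc ∘ ρ) (Fin.last m).castSucc
    · exact ihg (Fin.castSucc ∘ Fin.castSucc ∘ ρ) (Fin.last (m + 1))
    · exact var_eq_opair_var i.castSucc.castSucc (Fin.last m).castSucc (Fin.last (m + 1))

theorem subst {R : (σ → ZFSet.{u}) → (Fin n → M) → M → Prop} (hf : IsPairTerm f)
    (hR : Expressible fun S (v : Fin (n + 1) → M) => R S (Fin.init v) (v (Fin.last n))) :
    Expressible fun S v => R S v (f v) :=
  congr (.ex (.and (var_eq_comp hf Fin.castSucc (Fin.last n)) hR)) fun _ _ => exists_eq_left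

theorem eq (hf : IsPairTerm f) (hg : IsPairTerm g) :
    Expressible fun (_ : σ → ZFSet.{u}) v => f v = g v :=
  subst (R := fun _ v x => x = g v) hf (var_eq_comp hg Fin.castSucc (Fin.last n))

theorem pred (X : σ) (hf : IsPairTerm f) : Expressible fun S v => (f v).1 ∈ S X :=
  subst (R := fun S _ x => x.1 ∈ S X) hf (pred_var X (Fin.last n))

theorem unary {P : (σ → ZFSet.{u}) → (Fin 1 → M) → Prop} (hP : Expressible P)
    (hf : IsPairTerm f) : Expressible fun S v => P S fun _ => f v :=
  subst (R := fun S _ x => P S fun _ => x) hf (hP.comp fun _ => Fin.last n)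

end Expressible

theorem IsPairTerm.map {n : ℕ} {f : (Fin n → M) → M} (hf : IsPairTerm f) (k : M ↪ₑ[memLang] M)
    (v : Fin n → M) : k (f v) = f (k ∘ v) := by
  have hE := Expressible.var_eq_comp (σ := Empty) hf Fin.castSucc (Fin.last n)
  simpa only [Function.comp_apply, Fin.snoc_last, Function.comp_assoc, Fin.snoc_comp_castSucc]
    using (hE.map_iff k (Fin.snoc v (f v))).2 (by simp)

theorem map_empty (k : M ↪ₑ[memLang] M) : k ∅ = ∅ :=
  IsPairTerm.empty.map k (n := 0) Fin.elim0

theorem map_opair (k : M ↪ₑ[memLang] M) (x y : M) : k ⟪x, y⟫ = ⟪k x, k y⟫ :=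
  (IsPairTerm.pair (.var 0) (.var 1)).map k ![x, y]

variable (M) in
/-- Pairwise distinct elements of `M` which are fixed by all elementary embeddings. -/
def numeral : ℕ → M
  | 0 => ∅
  | n + 1 => ⟪∅, numeral n⟫

theorem numeral_injective : Function.Injective (numeral M) := by
  intro m n h
  induction m generalizing n with
  | zero => cases n with
    | zero => rfl
    | succ n => exact (opair_ne_empty _ _ h.symm).elim
  | succ m ih => cases n with
    | zero => exact (opair_ne_empty _ _ h).elim
    | succ n => exact congrArg Nat.succ (ih (opair_inj.1 h).2)

theorem map_numeral (k : M ↪ₑ[memLang] M) (n : ℕ) : k (numeral M n) = numeral M n := by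
  induction n with
  | zero => exact map_empty k
  | succ n ih => rw [numeral, map_opair, map_empty, ih]

/-- `K ∩ M` is the set of pairs `⟨x, k x⟩`. -/
def IsGraph (K : ZFSet.{u}) (k : M → M) : Prop :=
  ∀ z : M, z.1 ∈ K ↔ ∃ x, z = ⟪x, k x⟫

theorem IsGraph.opair_mem_iff {K : ZFSet.{u}} {k : M → M} (hK : IsGraph K k) {x y : M} :
    ⟪x, y⟫.1 ∈ K ↔ k x = y := by
  simp only [hK _, opair_inj, exists_eq_left', eq_comm]

variable (M) in
/-- `K` is the graph of a map `M → M` which fixes `∅` and commutes with pairing. -/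
structure IsPairHom (K : ZFSet.{u}) : Prop where
  exists_eq_opair : ∀ z : M, z.1 ∈ K → ∃ x y, z = ⟪x, y⟫
  exists_opair_mem_iff : ∀ x : M, ∃ y, ∀ y', ⟪x, y'⟫.1 ∈ K ↔ y = y'
  map_empty : ⟪(∅ : M), ∅⟫.1 ∈ K
  map_opair : ∀ x x' y y' : M, ⟪x, x'⟫.1 ∈ K → ⟪y, y'⟫.1 ∈ K → ⟪⟪x, y⟫, ⟪x', y'⟫⟫.1 ∈ K

variable (M) in
/-- The family of the sections `{t | ⟨c, t⟩ ∈ T}` is closed under the operations which generate the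
relations definable over `⟨M, ∈⟩`. The tuple `(v 0, …, v (n - 1))` is coded by the iterated pair
`⟨…⟨⟨∅, v 0⟩, v 1⟩, …⟩`. -/
structure IsDefinabilityClosed (T : ZFSet.{u}) : Prop where
  falsum : ∃ c : M, ∀ t, ⟪c, t⟫.1 ∉ T
  imp : ∀ c d : M, ∃ e, ∀ t, ⟪e, t⟫.1 ∈ T ↔ (⟪c, t⟫.1 ∈ T → ⟪d, t⟫.1 ∈ T)
  all : ∀ c : M, ∃ e, ∀ t, ⟪e, t⟫.1 ∈ T ↔ ∀ x, ⟪c, ⟪t, x⟫⟫.1 ∈ T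
  diagonal : ∃ c : M, ∀ t x y, ⟪c, ⟪⟪t, x⟫, y⟫⟫.1 ∈ T ↔ x = y
  weaken : ∀ c : M, ∃ e, ∀ t x y, ⟪e, ⟪⟪t, x⟫, y⟫⟫.1 ∈ T ↔ ⟪c, ⟪t, y⟫⟫.1 ∈ T
  eq : ∀ c d : M, ∃ e, ∀ t, ⟪e, t⟫.1 ∈ T ↔ ∃ x, ⟪c, ⟪t, x⟫⟫.1 ∈ T ∧ ⟪d, ⟪t, x⟫⟫.1 ∈ T
  mem : ∀ c d : M, ∃ e, ∀ t, ⟪e, t⟫.1 ∈ T ↔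
    ∃ x y, ⟪c, ⟪t, x⟫⟫.1 ∈ T ∧ ⟪d, ⟪t, y⟫⟫.1 ∈ T ∧ x.1 ∈ y.1

variable (M) in
/-- The map with graph `K` preserves and reflects membership in every section
`{t | ⟨c, t⟩ ∈ T}`. -/
def PreservesSections (K T : ZFSet.{u}) : Prop :=
  ∀ c t t' : M, ⟪t, t'⟫.1 ∈ K → (⟪c, t'⟫.1 ∈ T ↔ ⟪c, t⟫.1 ∈ T)

variable (M) in
/-- `B` is the value of the map with graph `K` at the subset `A` of `M`, that is, the union of its
values at the elements of `M` which are subsets of `A`. -/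
def IsApp (K A B : ZFSet.{u}) : Prop :=
  ∀ z : M, z.1 ∈ B ↔
    ∃ w y : M, (∀ u : M, u.1 ∈ w.1 → u.1 ∈ A) ∧ ⟪w, y⟫.1 ∈ K ∧ z.1 ∈ y.1

section

variable {σ : Type} (K T A B : σ)

theorem expressible_isPairHom :
    Expressible fun S (_ : Fin 0 → M) => IsPairHom M (S K) := by
  refine .congr (.and ?_ (.and ?_ (.and ?_ ?_))) fun S _ =>
    ⟨fun ⟨h₁, h₂, h₃, h₄⟩ => ⟨h₁, h₂, h₃, h₄⟩, fun h => ⟨h.1, h.2, h.3, h.4⟩⟩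
  · exact .all (.imp (.pred_var K _) (.ex (.ex (.var_eq_opair_var _ _ _))))
  · exact .all (.ex (.all (.iff (.pred K (.pair (.var _) (.var _))) (.eq_var _ _))))
  · exact .pred K (.pair .empty .empty)
  · exact .all (.all (.all (.all (.imp (.pred K (.pair (.var _) (.var _)))
      (.imp (.pred K (.pair (.var _) (.var _)))
        (.pred K (.pair (.pair (.var _) (.var _)) (.pair (.var _) (.var _)))))))))

theorem expressible_isDefinabilityClosed :
    Expressible fun S (_ : Fin 0 → M) => IsDefinabilityClosed M (S T) := by
  refine .congr (.and ?_ (.and ?_ (.and ?_ (.and ?_ (.and ?_ (.and ?_ ?_)))))) fun S _ =>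
    ⟨fun ⟨h₁, h₂, h₃, h₄, h₅, h₆, h₇⟩ => ⟨h₁, h₂, h₃, h₄, h₅, h₆, h₇⟩,
      fun h => ⟨h.1, h.2, h.3, h.4, h.5, h.6, h.7⟩⟩
  · exact .ex (.all (.not (.pred T (.pair (.var _) (.var _)))))
  · exact .all (.all (.ex (.all (.iff (.pred T (.pair (.var _) (.var _)))
      (.imp (.pred T (.pair (.var _) (.var _))) (.pred T (.pair (.var _) (.var _))))))))
  · exact .all (.ex (.all (.iff (.pred T (.pair (.var _) (.var _)))
      (.all (.pred T (.pair (.var _) (.pair (.var _) (.var _))))))))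
  · exact .ex (.all (.all (.all (.iff
      (.pred T (.pair (.var _) (.pair (.pair (.var _) (.var _)) (.var _)))) (.eq_var _ _)))))
  · exact .all (.ex (.all (.all (.all (.iff
      (.pred T (.pair (.var _) (.pair (.pair (.var _) (.var _)) (.var _))))
      (.pred T (.pair (.var _) (.pair (.var _) (.var _)))))))))
  · exact .all (.all (.ex (.all (.iff (.pred T (.pair (.var _) (.var _)))
      (.ex (.and (.pred T (.pair (.var _) (.pair (.var _) (.var _))))
        (.pred T (.pair (.var _) (.pair (.var _) (.var _))))))))))
  · exact .all (.all (.ex (.all (.iff (.pred T (.pair (.var _) (.var _)))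
      (.ex (.ex (.and (.pred T (.pair (.var _) (.pair (.var _) (.var _))))
        (.and (.pred T (.pair (.var _) (.pair (.var _) (.var _)))) (.mem_var _ _)))))))))

theorem expressible_preservesSections :
    Expressible fun S (_ : Fin 0 → M) => PreservesSections M (S K) (S T) :=
  .all (.all (.all (.imp (.pred K (.pair (.var _) (.var _)))
    (.iff (.pred T (.pair (.var _) (.var _))) (.pred T (.pair (.var _) (.var _)))))))

theorem expressible_isApp :
    Expressible fun S (_ : Fin 0 → M) => IsApp M (S K) (S A) (S B) :=
  .all (.iff (.pred_var B _) (.ex (.ex (.and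
    (.all (.imp (.mem_var _ _) (.pred_var A _)))
    (.and (.pred K (.pair (.var _) (.var _))) (.mem_var _ _))))))

end

/-- The code `⟨…⟨⟨∅, v 0⟩, v 1⟩, …⟩` of the tuple `v`. -/
def tuple : {n : ℕ} → (Fin n → M) → M
  | 0, _ => ∅
  | _ + 1, v => ⟪tuple (Fin.init v), v (Fin.last _)⟫

theorem tuple_snoc {n : ℕ} (v : Fin n → M) (x : M) :
    tuple (Fin.snoc v x : Fin (n + 1) → M) = ⟪tuple v, x⟫ := by
  rw [tuple, Fin.init_snoc, Fin.snoc_last]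

namespace IsDefinabilityClosed

variable {T : ZFSet.{u}}

theorem exists_projection (hT : IsDefinabilityClosed M T) {n : ℕ} (i : Fin n) :
    ∃ c : M, ∀ (v : Fin n → M) x, ⟪c, ⟪tuple v, x⟫⟫.1 ∈ T ↔ v i = x := by
  induction n with
  | zero => exact i.elim0
  | succ n ih =>
    cases i using Fin.lastCases with
    | last => exact hT.diagonal.imp fun c hc v x => hc _ _ _
    | cast i =>
      obtain ⟨c, hc⟩ := ih i
      exact (hT.weaken c).imp fun e he v x => (he _ _ _).trans (hc _ _)

theorem exists_section (hT : IsDefinabilityClosed M T) {n : ℕ}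
    (φ : memLang.BoundedFormula Empty n) :
    ∃ c : M, ∀ v : Fin n → M, ⟪c, tuple v⟫.1 ∈ T ↔ φ.Realize Empty.elim v := by
  induction φ with
  | falsum => exact hT.falsum.imp fun c hc v => iff_of_false (hc _) id
  | equal s t =>
    obtain ⟨i, hi⟩ := exists_realize_eq_var (M := M) s
    obtain ⟨k, hk⟩ := exists_realize_eq_var (M := M) t
    obtain ⟨c, hc⟩ := hT.exists_projection i
    obtain ⟨d, hd⟩ := hT.exists_projection k
    refine (hT.eq c d).imp fun e he v => (he _).trans ?_
    simp only [hc, hd, exists_eq_left', BoundedFormula.Realize, hi, hk]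
    exact eq_comm
  | @rel _ l R ts =>
    cases R with
    | var X => exact X.elim
    | mem =>
      obtain ⟨i, hi⟩ := exists_realize_eq_var (M := M) (ts 0)
      obtain ⟨k, hk⟩ := exists_realize_eq_var (M := M) (ts 1)
      obtain ⟨c, hc⟩ := hT.exists_projection i
      obtain ⟨d, hd⟩ := hT.exists_projection k
      refine (hT.mem c d).imp fun e he v => (he _).trans ?_
      change _ ↔ ((ts 0).realize (Sum.elim Empty.elim v)).1 ∈
        ((ts 1).realize (Sum.elim Empty.elim v)).1
      simp only [hc, hd, hi, hk, exists_and_left, exists_eq_left']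
  | imp φ ψ ihφ ihψ =>
    obtain ⟨c, hc⟩ := ihφ
    obtain ⟨d, hd⟩ := ihψ
    exact (hT.imp c d).imp fun e he v => (he _).trans (imp_congr (hc v) (hd v))
  | all φ ih =>
    obtain ⟨c, hc⟩ := ih
    refine (hT.all c).imp fun e he v => (he _).trans (forall_congr' fun x => ?_)
    rw [← tuple_snoc, hc]

end IsDefinabilityClosed

theorem IsPairHom.exists_isGraph {K : ZFSet.{u}} (hK : IsPairHom M K) :
    ∃ k : M → M, IsGraph K k := by
  choose k hk using hK.exists_opair_mem_iff
  refine ⟨k, fun z => ⟨fun hz => ?_, ?_⟩⟩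
  · obtain ⟨x, y, rfl⟩ := hK.exists_eq_opair z hz
    exact ⟨x, by rw [(hk x y).1 hz]⟩
  · rintro ⟨x, rfl⟩
    exact (hk x _).2 rfl

theorem IsPairHom.map_tuple {K : ZFSet.{u}} {k : M → M} (hK : IsPairHom M K) (hk : IsGraph K k)
    {n : ℕ} (v : Fin n → M) : k (tuple v) = tuple (k ∘ v) := by
  induction n with
  | zero => exact hk.opair_mem_iff.1 hK.map_empty
  | succ n ih =>
    have mem_graph (x : M) : ⟪x, k x⟫.1 ∈ K := hk.opair_mem_iff.2 rfl
    exact hk.opair_mem_iff.1 (hK.map_opair _ _ _ _ (ih (Fin.init v) ▸ mem_graph _) (mem_graph _))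

theorem exists_elementaryEmbedding_isGraph {K T : ZFSet.{u}} (hK : IsPairHom M K)
    (hT : IsDefinabilityClosed M T) (hKT : PreservesSections M K T) :
    ∃ k : M ↪ₑ[memLang] M, IsGraph K k := by
  obtain ⟨k, hk⟩ := hK.exists_isGraph
  refine ⟨⟨k, fun n φ v => ?_⟩, hk⟩
  obtain ⟨c, hc⟩ := hT.exists_section (BoundedFormula.relabel Sum.inr φ)
  rw [← Formula.realize_relabel_sumInr φ (v := Empty.elim), ← hc,
    ← Formula.realize_relabel_sumInr φ (v := Empty.elim), ← hc, ← hK.map_tuple hk]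
  exact hKT c _ _ (hk.opair_mem_iff.2 rfl)

theorem IsGraph.isPairHom {K : ZFSet.{u}} {k : M ↪ₑ[memLang] M} (hK : IsGraph K k) :
    IsPairHom M K where
  exists_eq_opair z hz := ((hK z).1 hz).imp fun x hx => ⟨k x, hx⟩
  exists_opair_mem_iff x := ⟨k x, fun _ => hK.opair_mem_iff⟩
  map_empty := hK.opair_mem_iff.2 (RankEmb.map_empty k)
  map_opair x x' y y' hx hy := by
    rw [hK.opair_mem_iff] at hx hy ⊢
    rw [RankEmb.map_opair, hx, hy]

/-- The set of the pairs `⟨c, t⟩` such that `t` satisfies the formula `f c`. -/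
noncomputable def satisfactionSet (f : M → memLang.Formula (Fin 1)) : ZFSet.{u} :=
  M.sep fun z => ∃ c t : M, z = ⟪c, t⟫.1 ∧ (f c).Realize fun _ => t

section SatisfactionSet

variable {f : M → memLang.Formula (Fin 1)}

theorem opair_mem_satisfactionSet {c t : M} :
    ⟪c, t⟫.1 ∈ satisfactionSet f ↔ (f c).Realize fun _ => t := by
  simp only [satisfactionSet, ZFSet.mem_sep, Subtype.prop, true_and, Subtype.coe_inj, opair_inj]
  exact ⟨fun ⟨_, _, ⟨hc, ht⟩, h⟩ => hc ▸ ht ▸ h, fun h => ⟨c, t, ⟨rfl, rfl⟩, h⟩⟩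

theorem expressible_opair_mem_satisfactionSet (c : M) {n : ℕ} {g : (Fin n → M) → M}
    (hg : IsPairTerm g) :
    Expressible fun (_ : Empty → ZFSet.{u}) v => ⟪c, g v⟫.1 ∈ satisfactionSet f := by
  refine Expressible.unary (P := fun _ v => ⟪c, v 0⟫.1 ∈ satisfactionSet f)
    ⟨f c, fun S v => ?_⟩ hg
  refine Iff.trans ?_ opair_mem_satisfactionSet.symm
  rw [Subsingleton.elim S fun X => X.elim]
  exact iff_of_eq (congrArg _ (funext fun i => congrArg v (Subsingleton.elim _ _)))

theorem preservesSections_satisfactionSet {K : ZFSet.{u}} {k : M ↪ₑ[memLang] M}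
    (hK : IsGraph K k) : PreservesSections M K (satisfactionSet f) := by
  intro c t t' h
  obtain rfl := hK.opair_mem_iff.1 h
  exact (expressible_opair_mem_satisfactionSet c (.var (0 : Fin 1))).map_iff k fun _ => t

theorem exists_section_satisfactionSet (hf : Function.Surjective f) {P : M → Prop}
    (hP : Expressible fun (_ : Empty → ZFSet.{u}) (v : Fin 1 → M) => P (v 0)) :
    ∃ c, ∀ t, ⟪c, t⟫.1 ∈ satisfactionSet f ↔ P t := by
  obtain ⟨φ, hφ⟩ := hP
  obtain ⟨c, rfl⟩ := hf φ
  exact ⟨c, fun t => opair_mem_satisfactionSet.trans (hφ (fun X => X.elim) fun _ => t)⟩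

theorem exists_section_satisfactionSet₃ (hf : Function.Surjective f) {P : M → M → M → Prop}
    (hP : Expressible fun (_ : Empty → ZFSet.{u}) (v : Fin 4 → M) => P (v 1) (v 2) (v 3)) :
    ∃ c, ∀ t x y, ⟪c, ⟪⟪t, x⟫, y⟫⟫.1 ∈ satisfactionSet f ↔ P t x y := by
  obtain ⟨c, hc⟩ := exists_section_satisfactionSet hf
    (P := fun s => ∃ t x y, s = ⟪⟪t, x⟫, y⟫ ∧ P t x y)
    (.ex (.ex (.ex (.and (.eq (.var _) (.pair (.pair (.var _) (.var _)) (.var _))) hP))))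
  refine ⟨c, fun t x y => (hc _).trans ⟨?_, fun h => ⟨t, x, y, rfl, h⟩⟩⟩
  rintro ⟨t', x', y', h, hP⟩
  obtain ⟨⟨rfl, rfl⟩, rfl⟩ := by simpa only [opair_inj] using h
  exact hP

theorem isDefinabilityClosed_satisfactionSet (hf : Function.Surjective f) :
    IsDefinabilityClosed M (satisfactionSet f) where
  falsum := (exists_section_satisfactionSet hf .false).imp fun _ hc t => (hc t).1
  imp c d := exists_section_satisfactionSet hf
    (.imp (expressible_opair_mem_satisfactionSet c (.var _))
      (expressible_opair_mem_satisfactionSet d (.var _)))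
  all c := exists_section_satisfactionSet hf
    (.all (expressible_opair_mem_satisfactionSet c (.pair (.var _) (.var _))))
  diagonal := exists_section_satisfactionSet₃ hf (.eq_var _ _)
  weaken c := exists_section_satisfactionSet₃ hf
    (expressible_opair_mem_satisfactionSet c (.pair (.var _) (.var _)))
  eq c d := exists_section_satisfactionSet hf
    (.ex (.and (expressible_opair_mem_satisfactionSet c (.pair (.var _) (.var _)))
      (expressible_opair_mem_satisfactionSet d (.pair (.var _) (.var _)))))
  mem c d := exists_section_satisfactionSet hf
    (.ex (.ex (.and (expressible_opair_mem_satisfactionSet c (.pair (.var _) (.var _)))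
      (.and (expressible_opair_mem_satisfactionSet d (.pair (.var _) (.var _)))
        (.mem_var _ _)))))

end SatisfactionSet

instance countable_symbols {σ : Type} [Countable σ] : Countable (setLang σ).Symbols := by
  have : Countable (Σ l, (setLang σ).Relations l) := by
    refine Function.Injective.countable (f := fun R : Σ l, SetRel σ l => show Option σ from
      match R with
      | ⟨_, .mem⟩ => none
      | ⟨_, .var X⟩ => some X) ?_
    rintro ⟨_, _ | X⟩ ⟨_, _ | Y⟩ h <;> simp_all
  have : IsEmpty (Σ l, (setLang σ).Functions l) := ⟨fun f => Empty.elim f.2⟩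
  exact inferInstanceAs (Countable (_ ⊕ _))

variable (M) in
theorem exists_surjective_formula : ∃ f : M → memLang.Formula (Fin 1), Function.Surjective f := by
  obtain ⟨f, hf⟩ := exists_surjective_nat (memLang.Formula (Fin 1))
  exact ⟨f ∘ Function.invFun (numeral M), hf.comp (Function.invFun_surjective numeral_injective)⟩

theorem exists_elementaryEmbedding_isGraph_iff {K : ZFSet.{u}} :
    (∃ k : M ↪ₑ[memLang] M, IsGraph K k) ↔
      IsPairHom M K ∧ ∃ T ⊆ M, IsDefinabilityClosed M T ∧ PreservesSections M K T := by
  constructor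
  · rintro ⟨k, hK⟩
    obtain ⟨f, hf⟩ := exists_surjective_formula M
    exact ⟨hK.isPairHom, satisfactionSet f, ZFSet.sep_subset,
      isDefinabilityClosed_satisfactionSet hf, preservesSections_satisfactionSet hK⟩
  · rintro ⟨hK, T, -, hT, hKT⟩
    exact exists_elementaryEmbedding_isGraph hK hT hKT



theorem map_mem_iff_opair_mem (k : M ↪ₑ[memLang] M) {c w y : M}
    (h : ∀ z : M, z.1 ∈ w.1 ↔ ⟪c, z⟫.1 ∈ y.1) (z : M) : z.1 ∈ (k w).1 ↔ ⟪k c, z⟫.1 ∈ (k y).1 := by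
  have hE : Expressible fun (_ : Empty → ZFSet.{u}) (v : Fin 3 → M) =>
      ∀ z : M, z.1 ∈ (v 1).1 ↔ ⟪v 0, z⟫.1 ∈ (v 2).1 :=
    .all (.iff (.mem_var _ _) (.subst (R := fun _ v x => x.1 ∈ (v 2).1)
      (.pair (.var _) (.var _)) (.mem_var _ _)))
  exact (hE.map_iff k ![c, w, y]).2 h z

theorem map_subset (k : M ↪ₑ[memLang] M) {x y : M} (h : x.1 ⊆ y.1) : (k x).1 ⊆ (k y).1 := by
  have hE : Expressible fun (_ : Empty → ZFSet.{u}) (v : Fin 2 → M) =>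
      ∀ z : M, z.1 ∈ (v 0).1 → z.1 ∈ (v 1).1 :=
    .all (.imp (.mem_var _ _) (.mem_var _ _))
  exact fun z hz => (hE.map_iff k ![x, y]).2 (fun _ => @h _) ⟨z, mem_of_mem_coe _ hz⟩ hz

section VonNeumann

variable {lam : Ordinal.{u}}

theorem mem_vonNeumann_add_one {x : ZFSet.{u}} : x ∈ V_ (lam + 1) ↔ x ⊆ V_ lam := by
  rw [ZFSet.vonNeumann_add_one, ZFSet.mem_powerset]

variable [hlim : Fact (Order.IsSuccLimit lam)]

instance isPairClosed_vonNeumann : IsPairClosed (V_ lam) where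
  isTransitive := ZFSet.isTransitive_vonNeumann lam
  empty_mem := by
    rw [ZFSet.mem_vonNeumann, ZFSet.rank_empty]
    exact hlim.out.bot_lt
  pair_mem := by
    simp only [ZFSet.mem_vonNeumann, ZFSet.pair, ZFSet.rank_pair, ZFSet.rank_singleton]
    intro x y hx hy
    simp only [max_lt_iff, hlim.out.succ_lt, hx, hy, and_self]

theorem prod_mem_vonNeumann {x y : ZFSet.{u}} (hx : x ∈ V_ lam) (hy : y ∈ V_ lam) :
    ZFSet.prod x y ∈ V_ lam := by
  rw [ZFSet.mem_vonNeumann] at hx hy ⊢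
  refine lt_of_le_of_lt (ZFSet.rank_le_iff.2 fun z hz => ?_)
    (hlim.out.succ_lt (hlim.out.succ_lt (max_lt hx hy)))
  obtain ⟨a, ha, b, hb, rfl⟩ := ZFSet.mem_prod.1 hz
  have ha := ZFSet.rank_lt_of_mem ha
  have hb := ZFSet.rank_lt_of_mem hb
  simp only [ZFSet.pair, ZFSet.rank_pair, ZFSet.rank_singleton, max_lt_iff,
    Order.succ_lt_succ_iff, lt_max_iff, ha, hb, true_or, or_true, and_self]

theorem mem_app {k : ElemEmb lam} {A z : ZFSet.{u}} :
    z ∈ app k A ↔ ∃ w : V_ lam, w.1 ⊆ A ∧ z ∈ (k w).1 := by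
  rw [app, ZFSet.mem_iUnion]
  constructor
  · rintro ⟨α, hα⟩
    exact ⟨_, fun u hu => (ZFSet.mem_inter.1 hu).1, hα⟩
  · rintro ⟨w, hw, hz⟩
    obtain ⟨α, hα, hwα⟩ := ZFSet.mem_vonNeumann'.1 w.2
    exact ⟨⟨α, hα⟩, map_subset k (fun u hu => ZFSet.mem_inter.2 ⟨hw hu, hwα hu⟩) hz⟩

theorem app_subset (k : ElemEmb lam) (A : ZFSet.{u}) : app k A ⊆ V_ lam := fun _ hz =>
  have ⟨w, _, hw⟩ := mem_app.1 hz
  mem_of_mem_coe (k w) hw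

theorem isGraph_graph (k : ElemEmb lam) : IsGraph (graph k) k := fun z => by
  simp only [graph, ZFSet.mem_range, Subtype.ext_iff, eq_comm (a := z.1)]
  rfl

theorem graph_subset (k : ElemEmb lam) : graph k ⊆ V_ lam := fun _ hz => by
  obtain ⟨x, rfl⟩ := ZFSet.mem_range.1 hz
  exact ⟪x, k x⟫.2

theorem IsGraph.eq_graph {K : ZFSet.{u}} {k : ElemEmb lam} (hK : IsGraph K k)
    (hKM : K ⊆ V_ lam) : K = graph k :=
  eq_of_forall_mem_iff hKM (graph_subset k) fun z => (hK z).trans (isGraph_graph k z).symm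

theorem isApp_graph_iff {k : ElemEmb lam} {A B : ZFSet.{u}} (hB : B ⊆ V_ lam) :
    IsApp (V_ lam) (graph k) A B ↔ app k A = B := by
  have mem_app_iff (z : V_ lam) : z.1 ∈ app k A ↔ ∃ w y : V_ lam,
      (∀ u : V_ lam, u.1 ∈ w.1 → u.1 ∈ A) ∧ ⟪w, y⟫.1 ∈ graph k ∧ z.1 ∈ y.1 := by
    simp only [(isGraph_graph k).opair_mem_iff, mem_app, exists_and_left, exists_eq_left']
    exact exists_congr fun w => and_congr_left fun _ =>
      ⟨fun h u => @h u, fun h u hu => h ⟨u, mem_of_mem_coe w hu⟩ hu⟩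
  simp only [IsApp, ← mem_app_iff]
  exact ⟨fun h => (eq_of_forall_mem_iff hB (app_subset k A) h).symm, fun h z => by rw [h]⟩

theorem IsSquareRoot.mem_E {k j : ElemEmb lam} (hkj : IsSquareRoot k j) (hj : j ∈ E lam) :
    k ∈ E lam := by
  by_contra hk
  have map_eq (x) : k x = x := not_not.1 (not_exists.1 hk x)
  obtain ⟨x, hx⟩ := hj
  have mem_app_graph : ⟪x, j x⟫.1 ∈ app k (graph k) := by
    rw [hkj]
    exact (isGraph_graph j).opair_mem_iff.2 rfl
  obtain ⟨w, hw, hxw⟩ := mem_app.1 mem_app_graph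
  rw [map_eq] at hxw
  exact hx (((isGraph_graph k).opair_mem_iff.1 (hw hxw)).symm.trans (map_eq x))

end VonNeumann

section SigmaOneOne

variable {lam : Ordinal.{u}} {j : ElemEmb lam}

theorem IsSigmaOneOne.exists_iff (hj : IsSigmaOneOne j) {p q r : ℕ}
    {P : (Fin p ⊕ Fin q → ZFSet.{u}) → (Fin r → V_ lam) → Prop} (hP : Expressible P)
    {A : Fin p → ZFSet.{u}} (hA : ∀ i, A i ⊆ V_ lam) (x : Fin r → V_ lam) :
    (∃ X : Fin q → ZFSet.{u}, (∀ i, X i ⊆ V_ lam) ∧ P (Sum.elim A X) x) ↔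
      ∃ X : Fin q → ZFSet.{u}, (∀ i, X i ⊆ V_ lam) ∧
        P (Sum.elim (fun i => app j (A i)) X) fun i => j (x i) := by
  obtain ⟨ψ, hψ⟩ := hP
  simpa only [SigmaHolds, hψ] using hj p q r ψ A x fun i => mem_vonNeumann_add_one.2 (hA i)

variable [Fact (Order.IsSuccLimit lam)]

theorem exists_isSquareRoot (hj : IsSigmaOneOne j) {A B : ZFSet.{u}} (hA : A ⊆ V_ lam)
    (hB : B ⊆ V_ lam) :
    ∃ k : ElemEmb lam, IsSquareRoot k j ∧ (∃ X ⊆ V_ lam, app k X = A) ∧ app k B = app j B := by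
  have hE : Expressible fun (S : Fin 4 ⊕ Fin 3 → ZFSet.{u}) (_ : Fin 0 → V_ lam) =>
      (IsPairHom (V_ lam) (S (.inr 0)) ∧ IsDefinabilityClosed (V_ lam) (S (.inr 1)) ∧
        PreservesSections (V_ lam) (S (.inr 0)) (S (.inr 1))) ∧
      IsApp (V_ lam) (S (.inr 0)) (S (.inr 0)) (S (.inl 0)) ∧
      IsApp (V_ lam) (S (.inr 0)) (S (.inr 2)) (S (.inl 1)) ∧
      IsApp (V_ lam) (S (.inr 0)) (S (.inl 2)) (S (.inl 3)) :=
    .and (.and (expressible_isPairHom _) (.and (expressible_isDefinabilityClosed _)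
      (expressible_preservesSections _ _))) (.and (expressible_isApp _ _ _)
        (.and (expressible_isApp _ _ _) (expressible_isApp _ _ _)))
  have hparam : ∀ i, ![graph j, A, B, app j B] i ⊆ V_ lam := by
    simpa [Fin.forall_fin_succ] using ⟨graph_subset j, hA, hB, app_subset j B⟩
  -- The second instance of the formula has the parameters `j · j`, `j · A`, `j · B`, `j · (j · B)`,
  -- so `j` itself, with `A` as preimage of `j · A`, witnesses it.
  obtain ⟨hK, T, hTM, hT, hKT⟩ := exists_elementaryEmbedding_isGraph_iff.1 ⟨j, isGraph_graph j⟩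
  obtain ⟨X, hX, ⟨hK, hT, hKT⟩, hroot, hrange, hvalue⟩ :=
    (hj.exists_iff hE hparam finZeroElim).2 ⟨![graph j, T, A],
      by simpa [Fin.forall_fin_succ] using ⟨graph_subset j, hTM, hA⟩, ⟨hK, hT, hKT⟩,
      (isApp_graph_iff (app_subset _ _)).2 rfl, (isApp_graph_iff (app_subset _ _)).2 rfl,
      (isApp_graph_iff (app_subset _ _)).2 rfl⟩
  obtain ⟨k, hk⟩ := exists_elementaryEmbedding_isGraph_iff.2 ⟨hK, X 1, hX 1, hT, hKT⟩
  simp only [Sum.elim_inl, Sum.elim_inr, hk.eq_graph (hX 0)] at hroot hrange hvalue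
  exact ⟨k, (isApp_graph_iff (graph_subset j)).1 hroot,
    ⟨X 2, hX 2, (isApp_graph_iff hA).1 hrange⟩, (isApp_graph_iff (app_subset j B)).1 hvalue⟩

end SigmaOneOne

section Family

/-- The section `{x ∈ M | ⟨c, x⟩ ∈ A}` of `A` at `c`. -/
noncomputable def fiber {M : ZFSet.{u}} (c : M) (A : ZFSet.{u}) : ZFSet.{u} :=
  M.sep fun x => ZFSet.pair c x ∈ A

/-- The set `{⟨c i, x⟩ | x ∈ a i}`, which codes the family `a` of subsets of `M` if the tags `c i`
are distinct. -/
noncomputable def familySet {M : ZFSet.{u}} {ι : Type*} (c : ι → M) (a : ι → ZFSet.{u}) :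
    ZFSet.{u} :=
  M.sep fun z => ∃ i, ∃ x ∈ a i, z = ZFSet.pair (c i) x

theorem coe_mem_fiber {c x : M} {A : ZFSet.{u}} : x.1 ∈ fiber c A ↔ ⟪c, x⟫.1 ∈ A :=
  ZFSet.mem_sep.trans (and_iff_right x.2)

theorem fiber_familySet {ι : Type*} {c : ι → M} (hc : Function.Injective c) {a : ι → ZFSet.{u}}
    (ha : ∀ i, a i ⊆ M) (i : ι) : fiber (c i) (familySet c a) = a i := by
  refine eq_of_forall_mem_iff ZFSet.sep_subset (ha i) fun x => coe_mem_fiber.trans ?_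
  refine ZFSet.mem_sep.trans ⟨?_, fun hx => ⟨Subtype.prop _, i, x, hx, rfl⟩⟩
  rintro ⟨-, k, y, hy, h⟩
  obtain ⟨hik, rfl⟩ := ZFSet.pair_inj.1 h
  rwa [hc (Subtype.ext hik)]

variable {lam : Ordinal.{u}}

theorem fiber_mem_vonNeumann (c y : V_ lam) : fiber c y ∈ V_ lam := by
  refine ZFSet.mem_vonNeumann.2 (lt_of_le_of_lt ?_ (ZFSet.mem_vonNeumann.1 y.2))
  refine ZFSet.rank_le_iff.2 fun x hx => lt_trans ?_ (ZFSet.rank_lt_of_mem (ZFSet.mem_sep.1 hx).2)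
  simp [ZFSet.pair]

variable [Fact (Order.IsSuccLimit lam)]

theorem app_fiber (k : ElemEmb lam) (c : V_ lam) (A : ZFSet.{u}) :
    app k (fiber c A) = fiber (k c) (app k A) := by
  refine eq_of_forall_mem_iff (app_subset k _) ZFSet.sep_subset fun z => ?_
  rw [coe_mem_fiber, mem_app, mem_app]
  constructor
  · rintro ⟨w, hw, hz⟩
    have singleton_mem : ({c.1} : ZFSet.{u}) ∈ V_ lam :=
      mem_of_mem_coe ⟪c, c⟫ (ZFSet.mem_pair.2 (.inl rfl))
    let y : V_ lam := ⟨ZFSet.prod {c.1} w, prod_mem_vonNeumann singleton_mem w.2⟩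
    have mem_iff (x : V_ lam) : x.1 ∈ w.1 ↔ ⟪c, x⟫.1 ∈ y.1 :=
      (ZFSet.pair_mem_prod.trans (and_iff_right (ZFSet.mem_singleton.2 rfl))).symm
    refine ⟨y, fun p hp => ?_, (map_mem_iff_opair_mem k mem_iff z).1 hz⟩
    obtain ⟨_, hc, x, hx, rfl⟩ := ZFSet.mem_prod.1 hp
    rw [ZFSet.mem_singleton.1 hc]
    exact (ZFSet.mem_sep.1 (hw hx)).2
  · rintro ⟨y, hy, hz⟩
    let w : V_ lam := ⟨fiber c y, fiber_mem_vonNeumann c y⟩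
    have mem_iff (x : V_ lam) : x.1 ∈ w.1 ↔ ⟪c, x⟫.1 ∈ y.1 := coe_mem_fiber
    refine ⟨w, fun x hx => ?_, (map_mem_iff_opair_mem k mem_iff z).2 hz⟩
    obtain ⟨hxM, hcx⟩ := ZFSet.mem_sep.1 (show x ∈ fiber c y.1 from hx)
    exact ZFSet.mem_sep.2 ⟨hxM, hy hcx⟩

theorem app_fiber_numeral (k : ElemEmb lam) (n : ℕ) (A : ZFSet.{u}) :
    app k (fiber (numeral (V_ lam) n) A) = fiber (numeral (V_ lam) n) (app k A) := by
  rw [app_fiber, map_numeral]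

end Family

end RankEmb

open RankEmb in
theorem lemma16_general (lam : Ordinal.{u}) (hlim : Order.IsSuccLimit lam)
    (j : ElemEmb lam) (hj : j ∈ E lam) (hjS : IsSigmaOneOne j)
    {ι κ : Type*} [Countable ι] [Countable κ] (a : ι → ZFSet.{u}) (b : κ → ZFSet.{u})
    (ha : ∀ i, a i ∈ V_ (lam + 1)) (hb : ∀ l, b l ∈ V_ (lam + 1)) :
    ∃ k ∈ E lam, IsSquareRoot k j ∧ (∀ i, a i ∈ extRange k) ∧ ∀ l, app k (b l) = app j (b l) := by
  have : Fact (Order.IsSuccLimit lam) := ⟨hlim⟩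
  obtain ⟨s, hs⟩ := exists_injective_nat ι
  obtain ⟨t, ht⟩ := exists_injective_nat κ
  obtain ⟨k, hkj, ⟨X, -, hX⟩, hB⟩ := exists_isSquareRoot hjS
    (A := familySet (numeral (V_ lam) ∘ s) a) (B := familySet (numeral (V_ lam) ∘ t) b)
    ZFSet.sep_subset ZFSet.sep_subset
  have fiber_a := fiber_familySet (M := V_ lam) (numeral_injective.comp hs) fun i =>
    mem_vonNeumann_add_one.1 (ha i)
  have fiber_b := fiber_familySet (M := V_ lam) (numeral_injective.comp ht) fun l =>
    mem_vonNeumann_add_one.1 (hb l)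
  refine ⟨k, hkj.mem_E hj, hkj, fun i => ⟨ha i, fiber (numeral _ (s i)) X,
    mem_vonNeumann_add_one.2 ZFSet.sep_subset, ?_⟩, fun l => ?_⟩
  · rw [app_fiber_numeral, hX]
    exact fiber_a i
  · rw [← fiber_b l, Function.comp_apply, app_fiber_numeral, app_fiber_numeral, hB]

theorem lemma16 (lam : Ordinal.{u}) (hlim : Order.IsSuccLimit lam) (hcof : lam.cof = ℵ₀)
    (j : RankEmb.ElemEmb lam) (hj : j ∈ RankEmb.E lam) (hjS : RankEmb.IsSigmaOneOne j)
    (m n : ℕ) (a : Fin (m + 1) → ZFSet.{u}) (b : Fin (n + 1) → ZFSet.{u})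
    (ha : ∀ i, a i ∈ V_ (lam + 1)) (hb : ∀ l, b l ∈ V_ (lam + 1)) :
    ∃ k ∈ RankEmb.E lam, RankEmb.IsSquareRoot k j ∧
      (∀ i, a i ∈ RankEmb.extRange k) ∧
      ∀ l, RankEmb.app k (b l) = RankEmb.app j (b l) :=
  lemma16_general lam hlim j hj hjS a b ha hb
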